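/- For a metric space $(X,d)$ with base point $x_0$, the metric compactification $\overline{X}^h\subset\mathbb{R}^X$ is the closure, in the topology of pointwise convergence, of the set of functions $x\mapsto d(x,y)-d(x_0,y)$, $y\in X$; its elements are called metric functionals on $X$. The metric compactification of $\mathbb{R}$ (with base point $0$) is $$\overline{\mathbb{R}}^h=\{\eta_r : r\in\mathbb{R}\}\cup\{\eta_{+\infty},\eta_{-\infty}\},\qquad \eta_r(s)=|s-r|-|r|,\quad \eta_{+\infty}(s)=-s,\quad \eta_{-\infty}(s)=s ,$$ and it carries the topology of pointwise convergence and its Borel $\sigma$-algebra. Let $(\Omega,\Sigma,\mathbb{P})$ be a non-atomic standard probability space, i.e. one that is isomorphic modulo null sets to $\mathbb{R}$ with a Borel probability measure (or with the completion of one), and let $L_1=L_1(\Omega,\Sigma,\mathbb{P};\mathbb{R})$ with base point $0$, so that $\overline{L_1}^h$ is the pointwise closure of the functionals $f\mapsto\|f-g\|_1-\|g\|_1$, $g\in L_1$. A random measure on $\overline{\mathbb{R}}^h$ is a family $\xi=(\xi_\omega)_{\omega\in\Omega}$ of Borel measures on $\overline{\mathbb{R}}^h$ such that $\omega\mapsto\int\varphi\,d\xi_\omega$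 is measurable for every continuous $\varphi:\overline{\mathbb{R}}^h\to\mathbb{R}$ and $\xi_\omega$ is a probability measure for $\mathbb{P}$-almost every $\omega$. If $\mathbf{h}\in\overline{L_1}^h$, then there exists a random measure $\xi$ on $\overline{\mathbb{R}}^h$ such that $$\mathbf{h}(f)=\int_\Omega\int_{\overline{\mathbb{R}}^h}\eta(f(\omega))\,d\xi_\omega(\eta)\,d\mathbb{P}(\omega)\qquad\text{for all } f\in L_1. \tag{1}$$ Conversely, if $\xi$ is a random measure on $\overline{\mathbb{R}}^h$, then for every $f\in L_1$ the integrals in (1) exist (the inner one for almost every $\omega$), and the functional $\mathbf{h}$ defined by (1) is an element of $\overline{L_1}^h$. -/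

import Mathlib

open MeasureTheory Set

noncomputable section

/-- The internal metric functional `x ↦ d(x, y) - d(x₀, y)` of the point `y`, for the base
point `x₀`. -/
def internalMetricFunctional {X : Type*} [PseudoMetricSpace X] (x₀ y : X) : X → ℝ :=
  fun x => dist x y - dist x₀ y

/-- The metric compactification of `X` with base point `x₀`: the closure of the internal metric
functionals for the topology of pointwise convergence on `X → ℝ`. Its elements are the metric
functionals on `X`. -/
def metricCompactification (X : Type*) [PseudoMetricSpace X] (x₀ : X) : Set (X → ℝ) :=
  closure (range (internalMetricFunctional x₀))

/-- The metric compactification of the real line (base point `0`) as a space of its own. -/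
def CompactifiedReal : Type := ↥(metricCompactification ℝ 0)

namespace CompactifiedReal

/-- The topology of pointwise convergence. -/
instance : TopologicalSpace CompactifiedReal :=
  inferInstanceAs (TopologicalSpace ↥(metricCompactification ℝ 0))

/-- The Borel σ-algebra of that topology. -/
instance : MeasurableSpace CompactifiedReal := borel CompactifiedReal

instance : BorelSpace CompactifiedReal := ⟨rfl⟩

/-- An element `η` of the compactified line is a function `ℝ → ℝ`. -/
instance : CoeFun CompactifiedReal (fun _ => ℝ → ℝ) := ⟨fun η => Subtype.val η⟩

end CompactifiedReal

/-- A probability space is standard if some measurable `f : Ω → ℝ` is an isomorphism modulo null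
sets onto `ℝ` with the image measure: off a null set, `f` is injective and maps measurable sets to
sets which are measurable up to null sets. Both a standard Borel space with a Borel probability
measure and its completion (a Lebesgue-Rokhlin space) are covered. -/
def IsStandardProbabilitySpace {Ω : Type*} [MeasurableSpace Ω] (P : Measure Ω) : Prop :=
  IsProbabilityMeasure P ∧
    ∃ f : Ω → ℝ, Measurable f ∧
      ∃ N : Set Ω, MeasurableSet N ∧ P Nᶜ = 0 ∧ InjOn f N ∧
        ∀ A ⊆ N, MeasurableSet A → NullMeasurableSet (f '' A) (P.map f)

/-- `P` has no atoms: every measurable set of positive measure has a measurable subset of strictly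
smaller positive measure. -/
def IsNonAtomic {Ω : Type*} [MeasurableSpace Ω] (P : Measure Ω) : Prop :=
  ∀ A, MeasurableSet A → 0 < P A → ∃ B ⊆ A, MeasurableSet B ∧ 0 < P B ∧ P B < P A

/-- `ξ` is a random measure on the compactified line: `ω ↦ ∫ φ dξ_ω` is measurable for every
continuous `φ`, and `ξ_ω` is a Borel probability measure for almost every `ω`. -/
structure IsRandomMeasure {Ω : Type*} [MeasurableSpace Ω] (P : Measure Ω)
    (ξ : Ω → Measure CompactifiedReal) : Prop where
  measurable_integral : ∀ φ : C(CompactifiedReal, ℝ), Measurable fun ω => ∫ η, φ η ∂(ξ ω)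
  isProbabilityMeasure : ∀ᵐ ω ∂P, IsProbabilityMeasure (ξ ω)

end

open Filter Topology
open scoped BoundedContinuousFunction ENNReal

noncomputable section

/-- The metric functional on the real line attached to a point of the extended line. -/
def extendedRealFunctional (x : EReal) (s : ℝ) : ℝ :=
  |s - (max (-(|s| : ℝ) : EReal) (min x (|s| : ℝ))).toReal| -
    |(max (-(|s| : ℝ) : EReal) (min x (|s| : ℝ))).toReal|

theorem extendedRealFunctional_coe (r s : ℝ) :
    extendedRealFunctional r s = |s - r| - |r| := by
  have : (max (-(|s| : ℝ) : EReal) (min (r : EReal) (|s| : ℝ))) = ((max (-|s|) (min r |s|) : ℝ)) := by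
    have hm : Monotone ((↑) : ℝ → EReal) := EReal.coe_strictMono.monotone
    rw [hm.map_max, hm.map_min, EReal.coe_neg]
  rw [extendedRealFunctional, this, EReal.toReal_coe]
  grind

theorem extendedRealFunctional_top : extendedRealFunctional ⊤ = fun s => -s := by
  funext s
  have : (-(|s| : ℝ) : EReal) ≤ (|s| : ℝ) := by
    rw [← EReal.coe_neg, EReal.coe_le_coe_iff]
    linarith [abs_nonneg s]
  rw [extendedRealFunctional, min_eq_right le_top, max_eq_right this, EReal.toReal_coe]
  grind

theorem extendedRealFunctional_bot : extendedRealFunctional ⊥ = fun s => s := by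
  funext s
  rw [extendedRealFunctional, min_eq_left bot_le, max_eq_left bot_le, ← EReal.coe_neg,
    EReal.toReal_coe]
  grind

theorem continuous_extendedRealFunctional : Continuous extendedRealFunctional := by
  refine continuous_pi fun s => ?_
  have hc : Continuous fun x : EReal => (max (-(|s| : ℝ) : EReal) (min x (|s| : ℝ))) := by fun_prop
  have h : Continuous fun x : EReal => (max (-(|s| : ℝ) : EReal) (min x (|s| : ℝ))).toReal := by
    refine EReal.continuousOn_toReal.comp_continuous hc fun x => ?_
    simp only [mem_compl_iff, mem_insert_iff, mem_singleton_iff, not_or]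
    constructor
    · refine (lt_of_lt_of_le ?_ (le_max_left _ _)).ne'
      rw [← EReal.coe_neg]; exact EReal.bot_lt_coe _
    · refine (max_lt ?_ (lt_of_le_of_lt (min_le_right _ _) (EReal.coe_lt_top _))).ne
      rw [← EReal.coe_neg]; exact EReal.coe_lt_top _
  unfold extendedRealFunctional
  fun_prop

theorem injective_extendedRealFunctional : Function.Injective extendedRealFunctional := by
  intro x y hxy
  induction x with
  | bot =>
    induction y with
    | bot => rfl
    | coe r =>
      rw [extendedRealFunctional_bot] at hxy
      have h := congrFun hxy (-|r| - 1)
      rw [extendedRealFunctional_coe] at h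
      grind
    | top =>
      rw [extendedRealFunctional_bot, extendedRealFunctional_top] at hxy
      have h := congrFun hxy 1
      norm_num at h
  | coe r =>
    induction y with
    | bot =>
      rw [extendedRealFunctional_bot] at hxy
      have h := congrFun hxy (-|r| - 1)
      rw [extendedRealFunctional_coe] at h
      grind
    | coe t =>
      have h1 := congrFun hxy r
      have h2 := congrFun hxy t
      rw [extendedRealFunctional_coe, extendedRealFunctional_coe] at h1 h2
      congr 1
      grind
    | top =>
      rw [extendedRealFunctional_top] at hxy
      have h := congrFun hxy (|r| + 1)
      rw [extendedRealFunctional_coe] at h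
      grind
  | top =>
    induction y with
    | bot =>
      rw [extendedRealFunctional_bot, extendedRealFunctional_top] at hxy
      have h := congrFun hxy 1
      norm_num at h
    | coe r =>
      rw [extendedRealFunctional_top] at hxy
      have h := congrFun hxy (|r| + 1)
      rw [extendedRealFunctional_coe] at h
      grind
    | top => rfl

theorem internalMetricFunctional_real (r : ℝ) :
    internalMetricFunctional (0 : ℝ) r = extendedRealFunctional r := by
  funext s
  simp [internalMetricFunctional, extendedRealFunctional_coe, Real.dist_eq]

theorem denseRange_coe_ereal : DenseRange ((↑) : ℝ → EReal) :=
  dense_of_exists_between fun a b hab => by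
    obtain ⟨c, h1, h2⟩ := EReal.lt_iff_exists_real_btwn.1 hab
    exact ⟨c, mem_range_self c, h1, h2⟩

theorem metricCompactification_real_eq_range :
    metricCompactification ℝ 0 = range extendedRealFunctional := by
  have hr : range (internalMetricFunctional (0 : ℝ)) =
      extendedRealFunctional '' range ((↑) : ℝ → EReal) := by
    rw [← range_comp]
    exact congrArg range (funext internalMetricFunctional_real)
  rw [metricCompactification, hr]
  apply Subset.antisymm
  · exact closure_minimal (image_subset_range _ _)
      (isCompact_range continuous_extendedRealFunctional).isClosed
  · rw [← image_univ, ← denseRange_coe_ereal.closure_range]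
    exact image_closure_subset_closure_image continuous_extendedRealFunctional

theorem range_extendedRealFunctional :
    range extendedRealFunctional =
      range (fun r : ℝ => fun s : ℝ => |s - r| - |r|) ∪ {fun s : ℝ => -s, fun s : ℝ => s} := by
  ext η
  constructor
  · rintro ⟨x, rfl⟩
    induction x with
    | bot => exact Or.inr (Or.inr extendedRealFunctional_bot)
    | coe r => exact Or.inl ⟨r, funext fun s => (extendedRealFunctional_coe r s).symm⟩
    | top => exact Or.inr (Or.inl extendedRealFunctional_top)
  · rintro (⟨r, rfl⟩ | rfl | rfl)
    · exact ⟨r, funext fun s => extendedRealFunctional_coe r s⟩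
    · exact ⟨⊤, extendedRealFunctional_top⟩
    · exact ⟨⊥, extendedRealFunctional_bot⟩

namespace CompactifiedReal

/-- The point of the compactified line attached to an extended real number. -/
def ofEReal (x : EReal) : CompactifiedReal :=
  ⟨extendedRealFunctional x, metricCompactification_real_eq_range ▸ mem_range_self x⟩

theorem ofEReal_apply (x : EReal) (s : ℝ) : ofEReal x s = extendedRealFunctional x s := rfl

theorem ofEReal_coe_apply (r s : ℝ) : ofEReal r s = |s - r| - |r| :=
  extendedRealFunctional_coe r s

theorem continuous_ofEReal : Continuous ofEReal :=
  continuous_extendedRealFunctional.subtype_mk _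

theorem bijective_ofEReal : Function.Bijective ofEReal := by
  refine ⟨fun x y h => injective_extendedRealFunctional (congrArg Subtype.val h), fun η => ?_⟩
  obtain ⟨x, hx⟩ : η.1 ∈ range extendedRealFunctional :=
    metricCompactification_real_eq_range ▸ η.2
  exact ⟨x, Subtype.ext hx⟩

instance : T2Space CompactifiedReal :=
  inferInstanceAs (T2Space ↥(metricCompactification ℝ 0))

/-- The compactified line is homeomorphic to the extended line. -/
def homeomorphEReal : EReal ≃ₜ CompactifiedReal :=
  Continuous.homeoOfEquivCompactToT2 (f := Equiv.ofBijective ofEReal bijective_ofEReal)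
    continuous_ofEReal

instance : CompactSpace CompactifiedReal := homeomorphEReal.compactSpace

instance : PolishSpace CompactifiedReal := homeomorphEReal.symm.isClosedEmbedding.polishSpace

instance : Nonempty CompactifiedReal := ⟨ofEReal 0⟩

theorem abs_apply_sub_apply_le (η : CompactifiedReal) (s t : ℝ) : |η s - η t| ≤ |s - t| := by
  obtain ⟨x, rfl⟩ := bijective_ofEReal.2 η
  rw [ofEReal_apply, ofEReal_apply]
  induction x with
  | bot => rw [extendedRealFunctional_bot]
  | coe r => rw [extendedRealFunctional_coe, extendedRealFunctional_coe]; grind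
  | top => rw [extendedRealFunctional_top]; grind

theorem abs_apply_le (η : CompactifiedReal) (s : ℝ) : |η s| ≤ |s| := by
  obtain ⟨x, rfl⟩ := bijective_ofEReal.2 η
  rw [ofEReal_apply]
  induction x with
  | bot => rw [extendedRealFunctional_bot]
  | coe r => rw [extendedRealFunctional_coe]; grind
  | top => rw [extendedRealFunctional_top]; grind

theorem continuous_apply_left (s : ℝ) : Continuous fun η : CompactifiedReal => η s :=
  (continuous_apply s).comp continuous_subtype_val

theorem continuous_apply_uncurry : Continuous fun p : CompactifiedReal × ℝ => p.1 p.2 := by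
  refine continuous_prod_of_continuous_lipschitzWith' _ 1 (fun η => ?_) (fun s => ?_)
  · exact LipschitzWith.of_dist_le_mul fun s t => by
      simpa [Real.dist_eq] using abs_apply_sub_apply_le η s t
  · exact continuous_apply_left s

end CompactifiedReal

namespace CompactifiedReal

theorem integrable_apply (μ : Measure CompactifiedReal) [IsFiniteMeasure μ] (s : ℝ) :
    Integrable (fun η : CompactifiedReal => η s) μ :=
  Integrable.of_bound (continuous_apply_left s).measurable.aestronglyMeasurable |s|
    (Eventually.of_forall fun η => abs_apply_le η s)

theorem abs_integral_apply_sub_le (μ : Measure CompactifiedReal) [IsProbabilityMeasure μ]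
    (s t : ℝ) : |(∫ η : CompactifiedReal, η s ∂μ) - ∫ η : CompactifiedReal, η t ∂μ| ≤ |s - t| := by
  rw [← integral_sub (integrable_apply μ s) (integrable_apply μ t), ← Real.norm_eq_abs]
  refine (norm_integral_le_of_norm_le_const (C := |s - t|)
    (Eventually.of_forall fun η => abs_apply_sub_apply_le η s t)).trans ?_
  simp

theorem abs_integral_apply_le (μ : Measure CompactifiedReal) [IsProbabilityMeasure μ]
    (s : ℝ) : |∫ η : CompactifiedReal, η s ∂μ| ≤ |s| := by
  rw [← Real.norm_eq_abs]
  refine (norm_integral_le_of_norm_le_const (C := |s|)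
    (Eventually.of_forall fun η => abs_apply_le η s)).trans ?_
  simp

end CompactifiedReal


open CompactifiedReal

variable {Ω : Type*} [MeasurableSpace Ω] {P : Measure Ω} {ξ : Ω → Measure CompactifiedReal}

namespace IsRandomMeasure

theorem aestronglyMeasurable_integral_apply (hξ : IsRandomMeasure P ξ) {f : Ω → ℝ}
    (hf : AEStronglyMeasurable f P) :
    AEStronglyMeasurable (fun ω => ∫ η : CompactifiedReal, η (f ω) ∂(ξ ω)) P := by
  obtain ⟨T, hT, hTm, hTp⟩ := hξ.isProbabilityMeasure.exists_measurable_mem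
  let u : ℝ → Ω → ℝ := fun s => T.indicator fun ω => ∫ η : CompactifiedReal, η s ∂(ξ ω)
  have hu : Measurable (Function.uncurry u) := by
    refine measurable_uncurry_of_continuous_of_measurable (fun ω => ?_) (fun s => ?_)
    · by_cases hω : ω ∈ T
      · have := hTp ω hω
        simp only [u, indicator_of_mem hω]
        refine (LipschitzWith.of_dist_le_mul (K := 1) fun s t => ?_).continuous
        simpa [Real.dist_eq] using abs_integral_apply_sub_le (ξ ω) s t
      · simp only [u, indicator_of_notMem hω]
        exact continuous_const
    · exact (hξ.measurable_integral ⟨_, continuous_apply_left s⟩).indicator hTm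
  refine ⟨fun ω => u (hf.mk f ω) ω, ?_, ?_⟩
  · exact (hu.comp (hf.stronglyMeasurable_mk.measurable.prodMk measurable_id)).stronglyMeasurable
  · filter_upwards [hT, hf.ae_eq_mk] with ω hω hfω
    simp only [u, indicator_of_mem hω, hfω]

theorem integrable_integral_apply (hξ : IsRandomMeasure P ξ) {f : Ω → ℝ} (hf : Integrable f P) :
    Integrable (fun ω => ∫ η : CompactifiedReal, η (f ω) ∂(ξ ω)) P := by
  refine hf.mono (hξ.aestronglyMeasurable_integral_apply hf.1) ?_
  filter_upwards [hξ.isProbabilityMeasure] with ω hω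
  exact abs_integral_apply_le (ξ ω) (f ω)

theorem abs_integral_integral_apply_sub_le (hξ : IsRandomMeasure P ξ) {f g : Ω → ℝ}
    (hf : Integrable f P) (hg : Integrable g P) :
    |(∫ ω, (∫ η : CompactifiedReal, η (f ω) ∂(ξ ω)) ∂P) -
      ∫ ω, (∫ η : CompactifiedReal, η (g ω) ∂(ξ ω)) ∂P| ≤ ∫ ω, |f ω - g ω| ∂P := by
  rw [← integral_sub (hξ.integrable_integral_apply hf) (hξ.integrable_integral_apply hg)]
  rw [← Real.norm_eq_abs]
  refine norm_integral_le_of_norm_le (hf.sub hg).abs ?_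
  filter_upwards [hξ.isProbabilityMeasure] with ω hω
  exact abs_integral_apply_sub_le (ξ ω) (f ω) (g ω)

end IsRandomMeasure

/-- The functional of the point `g` of `L₁`, as an integral. -/
theorem internalMetricFunctional_L1 (g f : Lp ℝ 1 P) :
    internalMetricFunctional (0 : Lp ℝ 1 P) g f = ∫ ω, ofEReal (g ω) (f ω) ∂P := by
  have hf := L1.integrable_coeFn f
  have hg := L1.integrable_coeFn g
  simp only [ofEReal_coe_apply]
  have e := integral_sub (f := fun ω => |f ω - g ω|) (hf.sub hg).abs hg.abs
  rw [e, internalMetricFunctional, L1.dist_eq_integral_dist,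
    dist_zero_left, L1.norm_eq_integral_norm]
  rfl

theorem abs_integral_ofEReal_sub_le {f₁ f₂ g : Ω → ℝ} (hf₁ : Integrable f₁ P)
    (hf₂ : Integrable f₂ P) (hg : Integrable g P) :
    |(∫ ω, ofEReal (g ω) (f₁ ω) ∂P) - ∫ ω, ofEReal (g ω) (f₂ ω) ∂P| ≤ ∫ ω, |f₁ ω - f₂ ω| ∂P := by
  have h : ∀ {f : Ω → ℝ}, Integrable f P → Integrable (fun ω => ofEReal (g ω) (f ω)) P := by
    intro f hf
    simp only [ofEReal_coe_apply]
    exact (hf.sub hg).abs.sub hg.abs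
  rw [← integral_sub (h hf₁) (h hf₂)]
  rw [← Real.norm_eq_abs]
  exact norm_integral_le_of_norm_le (hf₁.sub hf₂).abs
    (Eventually.of_forall fun ω => abs_apply_sub_apply_le _ _ _)

theorem IsStandardProbabilitySpace.exists_measurable_preimage_ae_eq
    (hP : IsStandardProbabilitySpace P) :
    ∃ f : Ω → ℝ, Measurable f ∧ ∀ A, MeasurableSet A → ∃ B, MeasurableSet B ∧ f ⁻¹' B =ᵐ[P] A := by
  obtain ⟨-, f, hf, N, hN, hPN, hinj, himg⟩ := hP
  refine ⟨f, hf, fun A hA => ?_⟩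
  obtain ⟨B, -, hB, hBeq⟩ :=
    (himg (A ∩ N) inter_subset_right (hA.inter hN)).exists_measurable_superset_ae_eq
  refine ⟨B, hB, ?_⟩
  have h1 : f ⁻¹' B =ᵐ[P] f ⁻¹' (f '' (A ∩ N)) :=
    (hf.measurePreserving P).quasiMeasurePreserving.preimage_ae_eq hBeq
  refine h1.trans ?_
  have hNae : ∀ᵐ ω ∂P, ω ∈ N := hPN
  filter_upwards [hNae] with ω hω
  refine propext ⟨?_, fun hA => ⟨ω, ⟨hA, hω⟩, rfl⟩⟩
  rintro ⟨ω', ⟨hA', hN'⟩, he⟩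
  exact hinj hN' hω he ▸ hA'

/-- If the σ-algebra is generated by `f` up to null sets, then continuous functions of `f` are
dense in `L₁`. -/
theorem exists_boundedContinuous_comp_eLpNorm_sub_le {X : Type*} [TopologicalSpace X]
    [NormalSpace X] [MeasurableSpace X] [BorelSpace X] [IsFiniteMeasure P] {f : Ω → X}
    (hf : Measurable f) [(P.map f).WeaklyRegular]
    (hgen : ∀ A, MeasurableSet A → ∃ B, MeasurableSet B ∧ f ⁻¹' B =ᵐ[P] A)
    {F : Ω → ℝ} (hF : MemLp F 1 P) {ε : ℝ≥0∞} (hε : ε ≠ 0) :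
    ∃ c : X →ᵇ ℝ, eLpNorm (F - c ∘ f) 1 P ≤ ε := by
  suffices h : ∃ G : Ω → ℝ, eLpNorm (F - G) 1 P ≤ ε ∧ ∃ c : X →ᵇ ℝ, c ∘ f = G by
    obtain ⟨_, hG, c, rfl⟩ := h
    exact ⟨c, hG⟩
  refine hF.induction_dense ENNReal.one_ne_top (fun G => ∃ c : X →ᵇ ℝ, c ∘ f = G) ?_ ?_ ?_ hε
  · intro a A hA _ δ hδ
    obtain ⟨B, hB, hBA⟩ := hgen A hA
    have hm : MemLp (B.indicator fun _ => a) 1 (P.map f) :=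
      memLp_indicator_const 1 hB a (Or.inr (measure_ne_top _ _))
    obtain ⟨c, hc, hcm⟩ := hm.exists_boundedContinuous_eLpNorm_sub_le ENNReal.one_ne_top hδ
    refine ⟨c ∘ f, ?_, c, rfl⟩
    rw [eLpNorm_sub_comm]
    have hms : AEStronglyMeasurable ((B.indicator fun _ => a) - ⇑c) (P.map f) := hm.1.sub hcm.1
    rw [eLpNorm_map_measure hms hf.aemeasurable] at hc
    refine (eLpNorm_congr_ae ?_).trans_le hc
    filter_upwards [hBA] with ω hω
    have hiff : f ω ∈ B ↔ ω ∈ A := iff_of_eq hω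
    by_cases h : ω ∈ A
    · simp [h, hiff.2 h]
    · have h' : f ω ∉ B := fun h' => h (hiff.1 h')
      simp [h, h']
  · rintro _ _ ⟨c, rfl⟩ ⟨d, rfl⟩
    exact ⟨c + d, rfl⟩
  · rintro _ ⟨c, rfl⟩
    exact (c.continuous.measurable.comp hf).aestronglyMeasurable

theorem integral_abs_sub_eq_toReal_eLpNorm {F G : Ω → ℝ} (hF : Integrable F P)
    (hG : Integrable G P) : ∫ ω, |F ω - G ω| ∂P = (eLpNorm (F - G) 1 P).toReal := by
  rw [eLpNorm_one_eq_lintegral_enorm, ← integral_norm_eq_lintegral_enorm (hF.sub hG).1]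
  rfl

/-- Compactness of Young measures: along an ultrafilter, the random Dirac measures at `g i`
converge to a random measure, tested against continuous functions of `f`. -/
theorem exists_randomMeasure_tendsto [IsProbabilityMeasure P] {X : Type*} [TopologicalSpace X]
    [CompactSpace X] [PolishSpace X] [MeasurableSpace X] [BorelSpace X] {f : Ω → X}
    (hf : Measurable f) {ι : Type*} (U : Ultrafilter ι) (g : ι → Ω → CompactifiedReal)
    (hg : ∀ i, Measurable (g i)) :
    ∃ ξ : Ω → Measure CompactifiedReal, IsRandomMeasure P ξ ∧ ∀ c : X →ᵇ ℝ,
      Tendsto (fun i => ∫ ω, g i ω (c (f ω)) ∂P) U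
        (𝓝 (∫ ω, (∫ η : CompactifiedReal, η (c (f ω)) ∂(ξ ω)) ∂P)) := by
  have hpair : ∀ i, Measurable fun ω => (f ω, g i ω) := fun i => hf.prodMk (hg i)
  let μ : ι → ProbabilityMeasure (X × CompactifiedReal) := fun i =>
    ⟨P.map fun ω => (f ω, g i ω), Measure.isProbabilityMeasure_map (hpair i).aemeasurable⟩
  obtain ⟨ν, -, hν⟩ := isCompact_univ.ultrafilter_le_nhds (U.map μ) (by simp)
  have hlim : Tendsto μ U (𝓝 ν) := hν
  let ρ : Measure (X × CompactifiedReal) := ν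
  have hfst : ρ.fst = P.map f := by
    have h1 := ProbabilityMeasure.tendsto_map_of_tendsto_of_continuous μ ν hlim
      (continuous_fst (X := X) (Y := CompactifiedReal))
    let π : ProbabilityMeasure X := ⟨P.map f, Measure.isProbabilityMeasure_map hf.aemeasurable⟩
    have h2 : ∀ i, (μ i).map (continuous_fst (X := X)
        (Y := CompactifiedReal)).measurable.aemeasurable = π := by
      intro i
      apply Subtype.ext
      change (P.map fun ω => (f ω, g i ω)).map Prod.fst = P.map f
      rw [Measure.map_map measurable_fst (hpair i)]
      rfl
    simp only [h2] at h1
    exact congrArg ProbabilityMeasure.toMeasure (tendsto_nhds_unique h1 tendsto_const_nhds)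
  refine ⟨fun ω => ρ.condKernel (f ω), ⟨fun φ => ?_, Eventually.of_forall fun ω => inferInstance⟩,
    fun c => ?_⟩
  · exact ((φ.continuous.stronglyMeasurable).integral_kernel (κ := ρ.condKernel)).measurable.comp hf
  · have hcont : Continuous fun p : X × CompactifiedReal => p.2 (c p.1) :=
      continuous_apply_uncurry.comp (continuous_snd.prodMk (c.continuous.comp continuous_fst))
    let Φ : (X × CompactifiedReal) →ᵇ ℝ := BoundedContinuousFunction.mkOfCompact ⟨_, hcont⟩
    have h3 := ProbabilityMeasure.tendsto_iff_forall_integral_tendsto.1 hlim Φ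
    have h4 : ∫ p, Φ p ∂ρ = ∫ ω, (∫ η : CompactifiedReal, η (c (f ω)) ∂(ρ.condKernel (f ω))) ∂P := by
      have hΦ : Integrable Φ ρ := Φ.integrable ρ
      have h6 : AEStronglyMeasurable (fun x => ∫ η, Φ (x, η) ∂(ρ.condKernel x)) (P.map f) :=
        hfst ▸ hΦ.1.integral_condKernel
      have h7 := ρ.integral_condKernel hΦ
      rw [hfst] at h7
      exact h7.symm.trans (integral_map hf.aemeasurable h6)
    have h5 : ∀ i, ∫ p, Φ p ∂(μ i : Measure (X × CompactifiedReal)) =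
        ∫ ω, g i ω (c (f ω)) ∂P := by
      intro i
      exact integral_map (hpair i).aemeasurable Φ.continuous.measurable.aestronglyMeasurable
    simp only [h5] at h3
    exact h4 ▸ h3

theorem exists_randomMeasure_of_mem_metricCompactification (hP : IsStandardProbabilitySpace P)
    {h : Lp ℝ 1 P → ℝ} (hh : h ∈ metricCompactification (Lp ℝ 1 P) 0) :
    ∃ ξ : Ω → Measure CompactifiedReal, IsRandomMeasure P ξ ∧
      ∀ f : Lp ℝ 1 P, h f = ∫ ω, (∫ η : CompactifiedReal, η (f ω) ∂(ξ ω)) ∂P := by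
  have := hP.1
  obtain ⟨e, he, hgen⟩ := hP.exists_measurable_preimage_ae_eq
  let f₀ : Ω → EReal := fun ω => e ω
  have hf₀ : Measurable f₀ := he.coe_real_ereal
  have hgen₀ : ∀ A, MeasurableSet A → ∃ B, MeasurableSet B ∧ f₀ ⁻¹' B =ᵐ[P] A := by
    intro A hA
    obtain ⟨B, hB, hBA⟩ := hgen A hA
    exact ⟨EReal.toReal ⁻¹' B, measurable_ereal_toReal hB, hBA⟩
  have hne : (comap (internalMetricFunctional (0 : Lp ℝ 1 P)) (𝓝 h)).NeBot :=
    comap_neBot_iff_frequently.2 (mem_closure_iff_frequently.1 hh)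
  let U : Ultrafilter (Lp ℝ 1 P) := Ultrafilter.of (comap (internalMetricFunctional 0) (𝓝 h))
  have hU : Tendsto (internalMetricFunctional (0 : Lp ℝ 1 P)) U (𝓝 h) :=
    tendsto_comap.mono_left (Ultrafilter.of_le _)
  obtain ⟨ξ, hξ, hlim⟩ := exists_randomMeasure_tendsto (P := P) hf₀ U
    (fun g ω => ofEReal (g ω))
    (fun g => continuous_ofEReal.measurable.comp
      (Lp.stronglyMeasurable g).measurable.coe_real_ereal)
  refine ⟨ξ, hξ, fun F => ?_⟩
  have hUF : Tendsto (fun g : Lp ℝ 1 P => ∫ ω, ofEReal (g ω) (F ω) ∂P) U (𝓝 (h F)) := by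
    simpa only [internalMetricFunctional_L1] using (tendsto_pi_nhds.1 hU F)
  have hFi := L1.integrable_coeFn F
  refine eq_of_forall_dist_le fun ε hε => ?_
  rw [Real.dist_eq]
  obtain ⟨c, hc⟩ := exists_boundedContinuous_comp_eLpNorm_sub_le hf₀ hgen₀ (Lp.memLp F)
    (ε := ENNReal.ofReal (ε / 2)) (by simpa using hε)
  have hci : Integrable (fun ω => c (f₀ ω)) P := by
    refine Integrable.of_bound (c.continuous.measurable.comp hf₀).aestronglyMeasurable ‖c‖
      (Eventually.of_forall fun ω => c.norm_coe_le_norm _)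
  have hd : ∫ ω, |F ω - c (f₀ ω)| ∂P ≤ ε / 2 := by
    rw [integral_abs_sub_eq_toReal_eLpNorm hFi hci]
    exact ENNReal.toReal_le_of_le_ofReal (by positivity) hc
  have h1 : |h F - ∫ ω, (∫ η : CompactifiedReal, η (c (f₀ ω)) ∂(ξ ω)) ∂P| ≤ ε / 2 := by
    refine le_of_tendsto (hUF.sub (hlim c)).abs (Eventually.of_forall fun g => ?_)
    exact (abs_integral_ofEReal_sub_le hFi hci (L1.integrable_coeFn g)).trans hd
  have h2 := (hξ.abs_integral_integral_apply_sub_le hFi hci).trans hd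
  rw [abs_le] at *
  constructor <;> linarith

theorem nullSingletonClass_map_restrict (hna : IsNonAtomic P) {e : Ω → ℝ} (he : Measurable e)
    (hgen : ∀ A, MeasurableSet A → ∃ B, MeasurableSet B ∧ e ⁻¹' B =ᵐ[P] A) (A : Set Ω) :
    NullSingletonClass ((P.restrict A).map e) := by
  refine ⟨fun x => ?_⟩
  rw [Measure.map_apply he (measurableSet_singleton x)]
  refine le_antisymm ((Measure.restrict_apply_le A _).trans ?_) zero_le
  by_contra hpos
  obtain ⟨B, hBx, hB, hB0, hBlt⟩ := hna _ (he (measurableSet_singleton x)) (not_le.1 hpos)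
  obtain ⟨C, -, hCB⟩ := hgen B hB
  rw [← measure_congr hCB] at hB0 hBlt
  by_cases hx : x ∈ C
  · exact hBlt.not_ge (measure_mono (preimage_mono (singleton_subset_iff.2 hx)))
  · refine hB0.ne' ?_
    rw [measure_congr hCB, ← measure_empty (μ := P)]
    have : (B : Set Ω) =ᵐ[P] (e ⁻¹' C ∩ B : Set Ω) := by
      filter_upwards [hCB] with ω hω
      have hiff : e ω ∈ C ↔ ω ∈ B := iff_of_eq hω
      exact propext ⟨fun h => ⟨hiff.2 h, h⟩, fun h => h.2⟩
    rw [measure_congr this]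
    congr 1
    ext ω
    simp only [mem_inter_iff, mem_preimage, mem_empty_iff_false, iff_false, not_and]
    intro hC hω
    exact hx ((hBx hω : e ω = x) ▸ hC)

theorem exists_measureReal_Iic_eq (ν : Measure ℝ) [IsFiniteMeasure ν] [NullSingletonClass ν] {a : ℝ}
    (ha : 0 < a) (ha' : a < ν.real univ) : ∃ x, ν.real (Iic x) = a := by
  have hc : Continuous fun x => ν.real (Iic x) := by
    have h1 : ∀ x, ν.real (Iic x) = ν.real (Iic 0) + ∫ _ in (0 : ℝ)..x, (1 : ℝ) ∂ν := by
      intro x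
      rw [← intervalIntegral.integral_Iic_sub_Iic (integrable_const _).integrableOn
        (integrable_const _).integrableOn]
      simp
    exact (continuous_const.add (intervalIntegral.continuous_primitive
      (fun _ _ => intervalIntegrable_const) 0)).congr fun x => (h1 x).symm
  have hbot : Tendsto (fun x => ν.real (Iic x)) atBot (𝓝 0) := by
    have h := tendsto_measure_iInter_atBot (μ := ν) (s := Iic)
      (fun x : ℝ => measurableSet_Iic.nullMeasurableSet) monotone_Iic ⟨0, measure_ne_top _ _⟩
    have hempty : ⋂ x : ℝ, Iic x = ∅ := by
      rw [iInter_Iic_eq_empty_iff]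
      simp [not_bddBelow_univ]
    rw [hempty, measure_empty] at h
    exact (ENNReal.tendsto_toReal ENNReal.zero_ne_top).comp h
  have htop : Tendsto (fun x => ν.real (Iic x)) atTop (𝓝 (ν.real univ)) :=
    (ENNReal.tendsto_toReal (measure_ne_top _ _)).comp (tendsto_measure_Iic_atTop ν)
  obtain ⟨x, hx⟩ := (hbot.eventually (gt_mem_nhds ha)).exists
  obtain ⟨y, hy⟩ := (htop.eventually (lt_mem_nhds ha')).exists
  exact mem_range_of_exists_le_of_exists_ge hc ⟨x, hx.le⟩ ⟨y, hy.le⟩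

theorem exists_subset_measureReal_eq (hP : IsStandardProbabilitySpace P) (hna : IsNonAtomic P)
    {A : Set Ω} (hA : MeasurableSet A) {t : ℝ} (ht : t ∈ Icc (0 : ℝ) 1) :
    ∃ B ⊆ A, MeasurableSet B ∧ P.real B = t * P.real A := by
  have := hP.1
  rcases ht.1.eq_or_lt with rfl | ht0
  · exact ⟨∅, empty_subset _, MeasurableSet.empty, by simp⟩
  rcases ht.2.eq_or_lt with rfl | ht1
  · exact ⟨A, Subset.rfl, hA, by simp⟩
  rcases (measureReal_nonneg (μ := P) (s := A)).eq_or_lt with h0 | hpos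
  · exact ⟨A, Subset.rfl, hA, by simp [← h0]⟩
  obtain ⟨e, he, hgen⟩ := hP.exists_measurable_preimage_ae_eq
  have := nullSingletonClass_map_restrict hna he hgen A
  have hν : ∀ s, MeasurableSet s → ((P.restrict A).map e).real s = P.real (e ⁻¹' s ∩ A) := by
    intro s hs
    rw [map_measureReal_apply he hs, measureReal_restrict_apply (he hs)]
  obtain ⟨x, hx⟩ := exists_measureReal_Iic_eq ((P.restrict A).map e) (a := t * P.real A)
    (by positivity) (by rw [hν _ MeasurableSet.univ, preimage_univ, univ_inter]; nlinarith)
  rw [hν _ measurableSet_Iic] at hx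
  exact ⟨_, inter_subset_right, (he measurableSet_Iic).inter hA, hx⟩

theorem integrable_ofEReal_simpleFunc_apply [IsFiniteMeasure P] (g : SimpleFunc Ω ℝ) (c : ℝ) :
    Integrable (fun ω => ofEReal (g ω) c) P :=
  Integrable.of_bound (((continuous_apply_left c).measurable.comp (continuous_ofEReal.measurable.comp
    measurable_coe_real_ereal)).comp g.measurable).aestronglyMeasurable |c|
    (Eventually.of_forall fun _ => abs_apply_le _ c)

theorem exists_simpleFunc_setIntegral_eq (hP : IsStandardProbabilitySpace P)
    (hna : IsNonAtomic P) {ι : Type*} (c : ι → ℝ) {y : ι → ℝ}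
    (hy : y ∈ convexHull ℝ (range fun r : ℝ => fun j => ofEReal r (c j))) :
    ∀ A, MeasurableSet A → ∃ g : SimpleFunc Ω ℝ, ∀ j,
      ∫ ω in A, ofEReal (g ω) (c j) ∂P = P.real A * y j := by
  have := hP.1
  refine convexHull_min (t := {y : ι → ℝ | ∀ A, MeasurableSet A → ∃ g : SimpleFunc Ω ℝ, ∀ j,
      ∫ ω in A, ofEReal (g ω) (c j) ∂P = P.real A * y j}) ?_ ?_ hy
  · rintro _ ⟨r, rfl⟩ A -
    exact ⟨SimpleFunc.const Ω r, fun j => by simp⟩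
  · intro y₁ h₁ y₂ h₂ a b ha hb hab A hA
    obtain ⟨B, hBA, hB, hPB⟩ := exists_subset_measureReal_eq hP hna hA (t := a)
      ⟨ha, by linarith⟩
    have hPB' : P.real (A \ B) = b * P.real A := by
      rw [measureReal_sdiff hBA hB, hPB, ← sub_eq_of_eq_add' hab.symm]
      ring
    obtain ⟨g₁, hg₁⟩ := h₁ B hB
    obtain ⟨g₂, hg₂⟩ := h₂ (A \ B) (hA.diff hB)
    refine ⟨SimpleFunc.piecewise B hB g₁ g₂, fun j => ?_⟩
    have hint := integrable_ofEReal_simpleFunc_apply (P := P) (SimpleFunc.piecewise B hB g₁ g₂) (c j)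
    have e₁ : ∫ ω in B, ofEReal (SimpleFunc.piecewise B hB g₁ g₂ ω) (c j) ∂P =
        P.real B * y₁ j := by
      rw [← hg₁ j]
      refine setIntegral_congr_fun hB fun ω hω => ?_
      simp [hω]
    have e₂ : ∫ ω in A \ B, ofEReal (SimpleFunc.piecewise B hB g₁ g₂ ω) (c j) ∂P =
        P.real (A \ B) * y₂ j := by
      rw [← hg₂ j]
      refine setIntegral_congr_fun (hA.diff hB) fun ω hω => ?_
      simp [hω.2]
    rw [← union_sdiff_cancel hBA, setIntegral_union disjoint_sdiff_right (hA.diff hB)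
      hint.integrableOn hint.integrableOn, e₁, e₂, union_sdiff_cancel hBA, hPB, hPB']
    simp only [Pi.add_apply, Pi.smul_apply, smul_eq_mul]
    ring

theorem integral_apply_mem_closure_convexHull (μ : Measure CompactifiedReal)
    [IsProbabilityMeasure μ] {ι : Type*} [Fintype ι] (c : ι → ℝ) :
    (fun j => ∫ η : CompactifiedReal, η (c j) ∂μ) ∈
      closure (convexHull ℝ (range fun r : ℝ => fun j => ofEReal r (c j))) := by
  let v : CompactifiedReal → ι → ℝ := fun η j => η (c j)
  have hv : Continuous v := continuous_pi fun j => continuous_apply_left (c j)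
  have hint : ∀ j, Integrable (fun η => v η j) μ := fun j => integrable_apply μ (c j)
  have hmem : ∀ η, v η ∈ closure (convexHull ℝ (range fun r : ℝ => fun j => ofEReal r (c j))) := by
    intro η
    have hd : DenseRange fun r : ℝ => ofEReal r :=
      bijective_ofEReal.2.denseRange.comp denseRange_coe_ereal continuous_ofEReal
    have h1 := mem_image_of_mem v (hd η)
    have h2 := image_closure_subset_closure_image hv h1
    rw [← range_comp] at h2
    exact closure_mono (subset_convexHull ℝ _) h2
  have h3 := (convex_convexHull ℝ (range fun r : ℝ => fun j => ofEReal r (c j))).closure.integral_mem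
    isClosed_closure (Eventually.of_forall hmem) (Integrable.of_eval hint)
  convert h3 using 1
  funext j
  exact (eval_integral hint j).symm

theorem exists_simpleFunc_abs_setIntegral_sub_le (hP : IsStandardProbabilitySpace P)
    (hna : IsNonAtomic P) (hξ : IsRandomMeasure P ξ) {ι : Type*} [Fintype ι] (c : ι → ℝ)
    {A : Set Ω} (hA : MeasurableSet A) {ε : ℝ} (hε : 0 < ε) :
    ∃ g : SimpleFunc Ω ℝ, ∀ j, |(∫ ω in A, ofEReal (g ω) (c j) ∂P) -
      ∫ ω in A, (∫ η : CompactifiedReal, η (c j) ∂(ξ ω)) ∂P| ≤ ε * P.real A := by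
  have := hP.1
  by_cases h0 : P A = 0
  · exact ⟨0, fun j => by simp [Measure.restrict_eq_zero.2 h0, measureReal_def, h0]⟩
  let H : Ω → ι → ℝ := fun ω j => ∫ η : CompactifiedReal, η (c j) ∂(ξ ω)
  have hint : ∀ j, Integrable (fun ω => H ω j) P := fun j =>
    hξ.integrable_integral_apply (integrable_const (c j))
  have havg : (⨍ ω in A, H ω ∂P) ∈
      closure (convexHull ℝ (range fun r : ℝ => fun j => ofEReal r (c j))) := by
    refine (convex_convexHull ℝ _).closure.set_average_mem isClosed_closure h0 (measure_ne_top _ _)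
      (ae_restrict_of_ae ?_) (Integrable.of_eval hint).integrableOn
    filter_upwards [hξ.isProbabilityMeasure] with ω hω
    exact integral_apply_mem_closure_convexHull (ξ ω) c
  obtain ⟨y, hy, hyd⟩ := Metric.mem_closure_iff.1 havg ε hε
  obtain ⟨g, hg⟩ := exists_simpleFunc_setIntegral_eq hP hna c hy A hA
  refine ⟨g, fun j => ?_⟩
  have hApos : 0 < P.real A := ENNReal.toReal_pos h0 (measure_ne_top _ _)
  have hj : ∫ ω in A, H ω j ∂P = P.real A * (⨍ ω in A, H ω ∂P) j := by
    rw [setAverage_eq, Pi.smul_apply, smul_eq_mul, mul_inv_cancel_left₀ hApos.ne']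
    exact (eval_integral (fun j => (hint j).integrableOn) j).symm
  have hdj := (dist_le_pi_dist (⨍ ω in A, H ω ∂P) y j).trans hyd.le
  change |_ - ∫ ω in A, H ω j ∂P| ≤ _
  rw [hg j, hj, ← mul_sub, abs_mul, abs_of_pos hApos, mul_comm, abs_sub_comm]
  exact mul_le_mul_of_nonneg_right hdj hApos.le

theorem integral_eq_sum_setIntegral_fiber {β : Type*} (s : SimpleFunc Ω β) {F : Ω → ℝ}
    (hF : Integrable F P) : ∫ ω, F ω ∂P = ∑ v ∈ s.range, ∫ ω in s ⁻¹' {v}, F ω ∂P := by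
  have hU : (⋃ v ∈ s.range, s ⁻¹' {v}) = univ := by
    refine eq_univ_of_forall fun ω => ?_
    simp only [mem_iUnion]
    exact ⟨s ω, s.mem_range_self ω, rfl⟩
  rw [← setIntegral_univ, ← hU]
  refine integral_biUnion_finset _ (fun v _ => s.measurableSet_fiber v) ?_
    fun v _ => hF.integrableOn
  intro v _ w _ hvw
  exact Disjoint.preimage _ (disjoint_singleton.2 hvw)

theorem exists_simpleFunc_abs_integral_sub_le (hP : IsStandardProbabilitySpace P)
    (hna : IsNonAtomic P) (hξ : IsRandomMeasure P ξ) {ι : Type*} [Fintype ι]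
    (s : SimpleFunc Ω (ι → ℝ)) (hs : ∀ j, Integrable (fun ω => s ω j) P) {ε : ℝ} (hε : 0 < ε) :
    ∃ g : SimpleFunc Ω ℝ, ∀ j, |(∫ ω, ofEReal (g ω) (s ω j) ∂P) -
      ∫ ω, (∫ η : CompactifiedReal, η (s ω j) ∂(ξ ω)) ∂P| ≤ ε := by
  have := hP.1
  choose g hg using fun v : ι → ℝ =>
    exists_simpleFunc_abs_setIntegral_sub_le hP hna hξ v (s.measurableSet_fiber v) hε
  refine ⟨s.bind g, fun j => ?_⟩
  have hint : Integrable (fun ω => ofEReal (s.bind g ω) (s ω j)) P := by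
    have h := (SimpleFunc.integrable_of_isFiniteMeasure (μ := P) (s.bind g))
    simp only [ofEReal_coe_apply]
    exact ((hs j).sub h).abs.sub h.abs
  rw [integral_eq_sum_setIntegral_fiber s hint,
    integral_eq_sum_setIntegral_fiber s (hξ.integrable_integral_apply (hs j)),
    ← Finset.sum_sub_distrib]
  have hone : ∑ v ∈ s.range, P.real (s ⁻¹' {v}) = 1 := by
    have := integral_eq_sum_setIntegral_fiber (P := P) s (integrable_const (1 : ℝ))
    simpa using this.symm
  calc |∑ v ∈ s.range, ((∫ ω in s ⁻¹' {v}, ofEReal (s.bind g ω) (s ω j) ∂P) -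
          ∫ ω in s ⁻¹' {v}, (∫ η : CompactifiedReal, η (s ω j) ∂(ξ ω)) ∂P)|
      ≤ ∑ v ∈ s.range, ε * P.real (s ⁻¹' {v}) := by
        refine (Finset.abs_sum_le_sum_abs _ _).trans (Finset.sum_le_sum fun v _ => ?_)
        have h1 : ∫ ω in s ⁻¹' {v}, ofEReal (s.bind g ω) (s ω j) ∂P =
            ∫ ω in s ⁻¹' {v}, ofEReal (g v ω) (v j) ∂P := by
          refine setIntegral_congr_fun (s.measurableSet_fiber v) fun ω hω => ?_
          have hω : s ω = v := hω
          simp only [SimpleFunc.bind_apply, hω]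
        have h2 : ∫ ω in s ⁻¹' {v}, (∫ η : CompactifiedReal, η (s ω j) ∂(ξ ω)) ∂P =
            ∫ ω in s ⁻¹' {v}, (∫ η : CompactifiedReal, η (v j) ∂(ξ ω)) ∂P := by
          refine setIntegral_congr_fun (s.measurableSet_fiber v) fun ω hω => ?_
          have hω : s ω = v := hω
          simp only [hω]
        rw [h1, h2]
        exact hg v j
    _ = ε := by rw [← Finset.mul_sum, hone, mul_one]

theorem IsRandomMeasure.mem_metricCompactification (hP : IsStandardProbabilitySpace P)
    (hna : IsNonAtomic P) (hξ : IsRandomMeasure P ξ) :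
    (fun f : Lp ℝ 1 P => ∫ ω, (∫ η : CompactifiedReal, η (f ω) ∂(ξ ω)) ∂P) ∈
      metricCompactification (Lp ℝ 1 P) 0 := by
  have := hP.1
  refine mem_closure_iff.2 fun O hO hmem => ?_
  obtain ⟨I, u, hu, hsub⟩ := isOpen_pi_iff.1 hO _ hmem
  have hev : ∀ᶠ ε : ℝ in 𝓝[>] 0, ∀ f ∈ I, Metric.ball
      (∫ ω, (∫ η : CompactifiedReal, η (f ω) ∂(ξ ω)) ∂P) ε ⊆ u f := by
    refine (Finset.eventually_all I).2 fun f hf => ?_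
    obtain ⟨δ, hδ, hball⟩ := Metric.isOpen_iff.1 (hu f hf).1 _ (hu f hf).2
    filter_upwards [Ioo_mem_nhdsGT hδ] with ε hε
    exact (Metric.ball_subset_ball hε.2.le).trans hball
  obtain ⟨ε, hball, hε⟩ := (hev.and self_mem_nhdsWithin).exists
  replace hε : 0 < ε := hε
  let F : Ω → I → ℝ := fun ω f => f.1 ω
  have hF : MemLp F 1 P := memLp_pi_iff.2 fun f => Lp.memLp f.1
  obtain ⟨s, hsd, hsm⟩ := hF.exists_simpleFunc_eLpNorm_sub_lt ENNReal.one_ne_top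
    (ε := ENNReal.ofReal (ε / 4)) (by simpa using hε)
  have hsi : ∀ f : I, Integrable (fun ω => s ω f) P := fun f =>
    memLp_one_iff_integrable.1 (memLp_pi_iff.1 hsm f)
  obtain ⟨g, hg⟩ := exists_simpleFunc_abs_integral_sub_le hP hna hξ s hsi
    (ε := ε / 4) (by positivity)
  have hgi : Integrable g P := SimpleFunc.integrable_of_isFiniteMeasure g
  refine ⟨_, hsub fun f hf => hball f hf ?_, hgi.toL1 g, rfl⟩
  have hfi := L1.integrable_coeFn f
  have hfs : ∫ ω, |f ω - s ω ⟨f, hf⟩| ∂P ≤ ε / 4 := by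
    rw [integral_abs_sub_eq_toReal_eLpNorm hfi (hsi ⟨f, hf⟩)]
    refine ENNReal.toReal_le_of_le_ofReal (by positivity) (le_trans ?_ hsd.le)
    exact eLpNorm_mono fun ω => norm_le_pi_norm ((F - s) ω) ⟨f, hf⟩
  have hG : internalMetricFunctional (0 : Lp ℝ 1 P) (hgi.toL1 g) f =
      ∫ ω, ofEReal (g ω) (f ω) ∂P := by
    rw [internalMetricFunctional_L1]
    refine integral_congr_ae ?_
    filter_upwards [hgi.coeFn_toL1] with ω hω
    rw [hω]
  rw [Metric.mem_ball, Real.dist_eq, hG]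
  have h1 := (abs_integral_ofEReal_sub_le hfi (hsi ⟨f, hf⟩) hgi).trans hfs
  have h2 := hg ⟨f, hf⟩
  have h3 := (hξ.abs_integral_integral_apply_sub_le hfi (hsi ⟨f, hf⟩)).trans hfs
  rw [abs_le] at h1 h2 h3
  rw [abs_lt]
  constructor <;> linarith

end

theorem theorem1 {Ω : Type*} [MeasurableSpace Ω] (P : Measure Ω)
    (hP : IsStandardProbabilitySpace P) (hna : IsNonAtomic P) :
    -- the metric compactification of the real line is the line with two added points
    (metricCompactification ℝ 0 =
      range (fun r : ℝ => fun s : ℝ => |s - r| - |r|) ∪ {fun s : ℝ => -s, fun s : ℝ => s}) ∧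
    -- every metric functional on `L₁` is represented by a random measure
    (∀ h ∈ metricCompactification (Lp ℝ 1 P) 0,
      ∃ ξ : Ω → Measure CompactifiedReal, IsRandomMeasure P ξ ∧
        ∀ f : Lp ℝ 1 P, h f = ∫ ω, (∫ η : CompactifiedReal, η (f ω) ∂(ξ ω)) ∂P) ∧
    -- every random measure defines a metric functional on `L₁`
    (∀ ξ : Ω → Measure CompactifiedReal, IsRandomMeasure P ξ →
      (∀ f : Lp ℝ 1 P,
        (∀ᵐ ω ∂P, Integrable (fun η : CompactifiedReal => η (f ω)) (ξ ω)) ∧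
        Integrable (fun ω => ∫ η : CompactifiedReal, η (f ω) ∂(ξ ω)) P) ∧
      (fun f : Lp ℝ 1 P => ∫ ω, (∫ η : CompactifiedReal, η (f ω) ∂(ξ ω)) ∂P) ∈
        metricCompactification (Lp ℝ 1 P) 0) := by
  refine ⟨metricCompactification_real_eq_range.trans range_extendedRealFunctional,
    fun h hh => exists_randomMeasure_of_mem_metricCompactification hP hh, fun ξ hξ => ⟨fun f => ⟨?_,
      hξ.integrable_integral_apply (L1.integrable_coeFn f)⟩, hξ.mem_metricCompactification hP hna⟩⟩
  filter_upwards [hξ.isProbabilityMeasure] with ω hω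
  exact CompactifiedReal.integrable_apply (ξ ω) (f ω)
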